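/- Let $\mathfrak H_A$, $\mathfrak H_B$ and $\mathfrak H$ be complex Hilbert spaces, let $A$ be a closed linear relation from $\mathfrak H_A$ to $\mathfrak H$, and let $B$ be a closed linear relation from $\mathfrak H_B$ to $\mathfrak H$; that is, $A\subset\mathfrak H_A\times\mathfrak H$ and $B\subset\mathfrak H_B\times\mathfrak H$ are closed linear subspaces. Then there exists a bounded (not necessarily closed) linear operator $W$ from $\operatorname{dom} A$ into $\overline{\operatorname{dom}}\, B$ such that $$A = BW$$ if and only if the following two conditions are satisfied: (i) $AA^{*}\le c^{2}BB^{*}$ for some $c\ge 0$; (ii) $\operatorname{mul} A=\operatorname{mul} B$. Here, for linear relations $T$ from $\mathfrak X$ to $\mathfrak Y$ and $S$ from $\mathfrak Y$ to $\mathfrak Z$: $\operatorname{dom} T=\{f:\{f,f'\}\in T \text{ for some } f'\}$; $\operatorname{mul} T=\{f':\{0,f'\}\in T\}$; $ST=\{\{f,f'\}:\{f,\varphi\}\in T,\ \{\varphi,f'\}\in S\text{ for some }\varphi\}$; an operator is identified with its graph; $aT=\{\{f,af'\}:\{f,f'\}\in T\}$ for a scalar $a$; $T^{*}=\{\{g,g'\}\in\mathfrak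 Y\times\mathfrak X:(f',g)=(f,g')\text{ for all }\{f,f'\}\in T\}$; and $T_{\rm s}=\{\{f,f'\}\in T: f'\perp\operatorname{mul}T\}$ is the operator part of $T$ for closed $T$. A relation $K$ in a Hilbert space is selfadjoint if $K=K^{*}$ and nonnegative if $(h',h)\ge 0$ for all $\{h,h'\}\in K$. Each nonnegative selfadjoint relation $K$ has a unique nonnegative selfadjoint square root $K^{1/2}$, i.e. $(K^{1/2})^{2}=K$. For nonnegative selfadjoint relations $K_1,K_2$, the inequality $K_1\le K_2$ means that $\operatorname{dom}(K_2^{1/2})_{\rm s}\subset\operatorname{dom}(K_1^{1/2})_{\rm s}$ and $\|(K_1^{1/2})_{\rm s}h\|\le\|(K_2^{1/2})_{\rm s}h\|$ for all $h\in\operatorname{dom}(K_2^{1/2})_{\rm s}$. -/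

import Mathlib

/-! Linear relations from `E` to `F` are linear subspaces of `E × F`, i.e. terms of
`Submodule ℂ (E × F)`. The adjoint relation is Mathlib's `Submodule.adjoint`. -/

namespace LinRel

section Algebra

variable {E F G : Type*} [AddCommGroup E] [Module ℂ E] [AddCommGroup F] [Module ℂ F]
  [AddCommGroup G] [Module ℂ G]

/-- The domain of a linear relation. -/
def dom (H : Submodule ℂ (E × F)) : Submodule ℂ E :=
  H.map (LinearMap.fst ℂ E F)

/-- The multivalued part `{f' | (0, f') ∈ H}` of a linear relation. -/
def mul (H : Submodule ℂ (E × F)) : Submodule ℂ F :=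
  H.comap (LinearMap.inr ℂ E F)

/-- The product `H₂ H₁` of linear relations: first `H₁`, then `H₂`. -/
def prod (H₂ : Submodule ℂ (F × G)) (H₁ : Submodule ℂ (E × F)) : Submodule ℂ (E × G) where
  carrier := {p | ∃ y : F, (p.1, y) ∈ H₁ ∧ (y, p.2) ∈ H₂}
  zero_mem' := ⟨0, H₁.zero_mem, H₂.zero_mem⟩
  add_mem' := by
    rintro p q ⟨y, hy₁, hy₂⟩ ⟨z, hz₁, hz₂⟩
    exact ⟨y + z, H₁.add_mem hy₁ hz₁, H₂.add_mem hy₂ hz₂⟩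
  smul_mem' := by
    rintro a p ⟨y, hy₁, hy₂⟩
    exact ⟨a • y, H₁.smul_mem a hy₁, H₂.smul_mem a hy₂⟩

/-- The scalar multiple `a H = {(f, a f') | (f, f') ∈ H}` of a linear relation. -/
def scale (a : ℂ) (H : Submodule ℂ (E × F)) : Submodule ℂ (E × F) :=
  H.map (LinearMap.prodMap (LinearMap.id : E →ₗ[ℂ] E) (a • (LinearMap.id : F →ₗ[ℂ] F)))

/-- The graph `{(f, W f) | f ∈ D}` in `E × F` of a linear map `W` defined on a subspace `D` of `E`
with values in a subspace `R` of `F`. -/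
def ofMap {D : Submodule ℂ E} {R : Submodule ℂ F} (W : D →ₗ[ℂ] R) : Submodule ℂ (E × F) :=
  LinearPMap.graph ⟨D, R.subtype.comp W⟩

end Algebra

section Hilbert

variable {E F : Type*} [NormedAddCommGroup E] [InnerProductSpace ℂ E]
  [NormedAddCommGroup F] [InnerProductSpace ℂ F]

/-- The operator part `H_s = H ⊖ ({0} × mul H)` of a linear relation: the pairs `(f, f') ∈ H`
with `f'` orthogonal to `mul H`. -/
noncomputable def opPart (H : Submodule ℂ (E × F)) : Submodule ℂ (E × F) :=
  H ⊓ (mul H)ᗮ.comap (LinearMap.snd ℂ E F)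

/-- A linear relation in `E` is nonnegative if `(h', h)` is real and nonnegative for
all `(h, h') ∈ H`. -/
def Nonneg (H : Submodule ℂ (E × E)) : Prop :=
  ∀ h h' : E, (h, h') ∈ H → 0 ≤ (inner ℂ h' h).re ∧ (inner ℂ h' h).im = 0

/-- `K` is a square root of the relation `H`: it is a nonnegative selfadjoint relation with
`K² = H`. (A nonnegative selfadjoint relation has exactly one, and any relation that has one is
nonnegative and selfadjoint.) -/
def IsSqrt (K H : Submodule ℂ (E × E)) : Prop :=
  Nonneg K ∧ K.adjoint = K ∧ prod K K = H

/-- The ordering `H₁ ≤ H₂` of nonnegative selfadjoint relations: the operator parts `S₁`, `S₂` of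
the square roots of `H₁`, `H₂` satisfy `dom S₂ ⊆ dom S₁` and `‖S₁ h‖ ≤ ‖S₂ h‖` for
all `h ∈ dom S₂`. -/
def Le (H₁ H₂ : Submodule ℂ (E × E)) : Prop :=
  ∃ K₁ K₂ : Submodule ℂ (E × E), IsSqrt K₁ H₁ ∧ IsSqrt K₂ H₂ ∧
    dom (opPart K₂) ≤ dom (opPart K₁) ∧
    ∀ h h₁ h₂ : E, (h, h₁) ∈ opPart K₁ → (h, h₂) ∈ opPart K₂ → ‖h₁‖ ≤ ‖h₂‖

end Hilbert

end LinRel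

namespace LinRel

open ContinuousLinearMap

/-! ### Membership criteria for relations. -/

section Algebra

variable {E F G : Type*} [AddCommGroup E] [Module ℂ E] [AddCommGroup F] [Module ℂ F]
  [AddCommGroup G] [Module ℂ G]

/-! Both sides reduce to one condition, `Dominated c A.adjoint B.adjoint`: `dom B* ⊆ dom A*`, and
`A*` has values of norm at most `c` times those of `B*`.

For the order condition: if `K` is the square root of `T*T`, then `K*K = K² = T*T`. When `y ∈ Tx`
and `w ∈ T*y`, the form `(x, w)` is `‖y‖²`, so `T*T` determines the norms of the operator part of
`T` on `dom T*T`, which is a core. Hence `K` and `T` dominate each other; apply this to `T = A*` and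
`T = B*`, with `T* = A` and `T* = B` (`exists_le_scale_iff`).

For the factorization: domination yields a bounded `Z` with `Z B*_s = A*_s`, and `W` is `Z*`
restricted to `dom A`. Duality gives `A ⊆ BW`; equality of the multivalued parts upgrades this to `A
= BW`. Conversely, if `A = BW` and `Z` is a bounded extension of `W`, then `Z* B* ⊆ A*`. -/

theorem mem_dom {T : Submodule ℂ (E × F)} {x : E} : x ∈ dom T ↔ ∃ y, (x, y) ∈ T := by
  simp [dom]

theorem mem_mul {T : Submodule ℂ (E × F)} {y : F} : y ∈ mul T ↔ ((0 : E), y) ∈ T := Iff.rfl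

theorem mem_prod {S : Submodule ℂ (F × G)} {T : Submodule ℂ (E × F)} {x : E} {z : G} :
    (x, z) ∈ prod S T ↔ ∃ y, (x, y) ∈ T ∧ (y, z) ∈ S := Iff.rfl

theorem mem_scale {a : ℂ} {T : Submodule ℂ (E × F)} {x : E} {y : F} :
    (x, y) ∈ scale a T ↔ ∃ z, (x, z) ∈ T ∧ a • z = y := by
  simp [scale]

theorem mem_scale_iff {a : ℂ} (ha : a ≠ 0) {T : Submodule ℂ (E × F)} {x : E} {y : F} :
    (x, y) ∈ scale a T ↔ (x, a⁻¹ • y) ∈ T := by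
  rw [mem_scale]
  constructor
  · rintro ⟨z, hz, rfl⟩
    rwa [inv_smul_smul₀ ha]
  · exact fun h => ⟨_, h, smul_inv_smul₀ ha y⟩

theorem mem_ofMap {D : Submodule ℂ E} {R : Submodule ℂ F} {W : D →ₗ[ℂ] R} {x : E} {y : F} :
    (x, y) ∈ ofMap W ↔ ∃ hx : x ∈ D, (W ⟨x, hx⟩ : F) = y := by
  simp only [ofMap, LinearPMap.mem_graph_iff]
  constructor
  · rintro ⟨z, rfl, h⟩
    exact ⟨z.2, h⟩
  · rintro ⟨hx, h⟩
    exact ⟨⟨x, hx⟩, rfl, h⟩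

end Algebra

/-! ### Adjoints, operator parts, and the square root of `T*T`. -/

section Hilbert

variable {E F G : Type*} [NormedAddCommGroup E] [InnerProductSpace ℂ E]
  [NormedAddCommGroup F] [InnerProductSpace ℂ F]

theorem inner_self_eq (x : E) : inner ℂ x x = ((‖x‖ ^ 2 : ℝ) : ℂ) := by
  rw [inner_self_eq_norm_sq_to_K, Complex.ofReal_pow]
  rfl

theorem mem_adjoint {T : Submodule ℂ (E × F)} {x : F} {y : E} :
    (x, y) ∈ T.adjoint ↔ ∀ a b, (a, b) ∈ T → inner ℂ b x = inner ℂ a y := by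
  rw [Submodule.mem_adjoint_iff]
  exact forall₃_congr fun _ _ _ => sub_eq_zero

theorem isClosed_adjoint (T : Submodule ℂ (E × F)) : IsClosed (T.adjoint : Set (F × E)) := by
  have : (T.adjoint : Set (F × E)) =
      ⋂ a, ⋂ b, ⋂ (_ : (a, b) ∈ T), {p : F × E | inner ℂ b p.1 = inner ℂ a p.2} := by
    ext ⟨x, y⟩
    simp only [SetLike.mem_coe, mem_adjoint, Set.mem_iInter, Set.mem_ofPred_eq]
  rw [this]
  exact isClosed_iInter fun a => isClosed_iInter fun b => isClosed_iInter fun _ =>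
    isClosed_eq (by fun_prop) (by fun_prop)

theorem isClosed_mul {T : Submodule ℂ (E × F)} (hT : IsClosed (T : Set (E × F))) :
    IsClosed (mul T : Set F) :=
  hT.preimage (f := fun y : F => ((0 : E), y)) (by fun_prop)

theorem mem_opPart {T : Submodule ℂ (E × F)} {x : E} {y : F} :
    (x, y) ∈ opPart T ↔ (x, y) ∈ T ∧ y ∈ (mul T)ᗮ := Iff.rfl

theorem isClosed_opPart {T : Submodule ℂ (E × F)} (hT : IsClosed (T : Set (E × F))) :
    IsClosed (opPart T : Set (E × F)) :=
  hT.inter ((mul T).isClosed_orthogonal.preimage continuous_snd)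

theorem norm_le_of_mem_opPart {T : Submodule ℂ (E × F)} {x : E} {y z : F}
    (hy : (x, y) ∈ opPart T) (hz : (x, z) ∈ T) : ‖y‖ ≤ ‖z‖ := by
  have h : z - y ∈ mul T := by
    have := T.sub_mem hz hy.1
    simpa [mem_mul] using this
  have h0 : inner ℂ y (z - y) = 0 := Submodule.inner_left_of_mem_orthogonal h hy.2
  have h1 := norm_add_sq_eq_norm_sq_add_norm_sq_of_inner_eq_zero y (z - y) h0
  rw [add_sub_cancel] at h1
  nlinarith [norm_nonneg z, norm_nonneg y, mul_self_nonneg ‖z - y‖]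

theorem exists_mem_opPart [CompleteSpace F] {T : Submodule ℂ (E × F)}
    (hT : IsClosed (T : Set (E × F))) {x : E} {y : F} (h : (x, y) ∈ T) :
    ∃ z, (x, z) ∈ opPart T ∧ ‖z‖ ≤ ‖y‖ := by
  have : CompleteSpace (mul T) := (isClosed_mul hT).completeSpace_coe
  have hmem : (x, y - (mul T).starProjection y) ∈ opPart T := by
    refine mem_opPart.2 ⟨?_, Submodule.sub_starProjection_mem_orthogonal y⟩
    have h1 : ((0 : E), (mul T).starProjection y) ∈ T :=
      mem_mul.1 (Submodule.starProjection_apply_mem _ y)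
    simpa using T.sub_mem h h1
  exact ⟨_, hmem, norm_le_of_mem_opPart hmem h⟩

/-- Projecting onto a closed relation `T` leaves a remainder which, after a flip, lies in the
adjoint relation. -/
theorem exists_projection [CompleteSpace E] [CompleteSpace F] {T : Submodule ℂ (E × F)}
    (hT : IsClosed (T : Set (E × F))) :
    ∃ P : (E × F) →L[ℂ] (E × F), ∀ z, P z ∈ T ∧ (z.2 - (P z).2, (P z).1 - z.1) ∈ T.adjoint := by
  -- The product carries the sup norm; its `L²` version is the Hilbert space in which to project.
  let φ := WithLp.prodContinuousLinearEquiv 2 ℂ E F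
  let U : Submodule ℂ (WithLp 2 (E × F)) := T.comap (φ : WithLp 2 (E × F) →ₗ[ℂ] E × F)
  have : CompleteSpace U :=
    (show IsClosed (U : Set (WithLp 2 (E × F))) from
      hT.preimage φ.continuous).completeSpace_coe
  refine ⟨(φ : WithLp 2 (E × F) →L[ℂ] E × F) ∘L U.starProjection ∘L
    (φ.symm : (E × F) →L[ℂ] WithLp 2 (E × F)), fun z => ?_⟩
  have h1 : U.starProjection (φ.symm z) ∈ U := Submodule.starProjection_apply_mem _ _
  have h2 : φ.symm z - U.starProjection (φ.symm z) ∈ Uᗮ :=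
    Submodule.sub_starProjection_mem_orthogonal _
  refine ⟨h1, mem_adjoint.2 fun a b hab => ?_⟩
  have h3 := h2 (φ.symm (a, b)) (by simpa [U] using hab)
  rw [WithLp.prod_inner_apply] at h3
  have h4 : inner ℂ a (z.1 - (φ (U.starProjection (φ.symm z))).1)
      + inner ℂ b (z.2 - (φ (U.starProjection (φ.symm z))).2) = 0 := h3
  change inner ℂ b (z.2 - (φ (U.starProjection (φ.symm z))).2) =
    inner ℂ a ((φ (U.starProjection (φ.symm z))).1 - z.1)
  rw [← neg_sub z.1, inner_neg_right]
  linear_combination h4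

theorem adjoint_adjoint [CompleteSpace E] [CompleteSpace F] {T : Submodule ℂ (E × F)}
    (hT : IsClosed (T : Set (E × F))) : T.adjoint.adjoint = T := by
  apply le_antisymm
  · rintro ⟨x, y⟩ hxy
    obtain ⟨P, hP⟩ := exists_projection hT
    obtain ⟨⟨a, b⟩, h1, h2⟩ : ∃ p : E × F, p ∈ T ∧ (y - p.2, p.1 - x) ∈ T.adjoint :=
      ⟨P (x, y), hP (x, y)⟩
    dsimp only at h1 h2
    have h3 := mem_adjoint.1 hxy _ _ h2
    have h4 := mem_adjoint.1 h2 _ _ h1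
    have h4' : inner ℂ (y - b) b = inner ℂ (a - x) a := by
      rw [← inner_conj_symm, h4, inner_conj_symm]
    -- The remainder in `T*` is paired with `(x, y) ∈ T**` and with `(a, b) ∈ T`; the difference is
    -- its squared norm.
    have h5 : inner ℂ (y - b) (y - b) + inner ℂ (x - a) (x - a) = 0 := by
      rw [inner_sub_right, inner_sub_right, ← neg_sub a x, inner_neg_left, inner_neg_left]
      linear_combination -h3 - h4'
    have h6 : ‖y - b‖ ^ 2 + ‖x - a‖ ^ 2 = 0 := by
      rw [inner_self_eq, inner_self_eq] at h5
      exact_mod_cast h5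
    have h7 : y - b = 0 := by
      rw [← norm_eq_zero]
      nlinarith [sq_nonneg ‖y - b‖, sq_nonneg ‖x - a‖]
    have h8 : x - a = 0 := by
      rw [← norm_eq_zero]
      nlinarith [sq_nonneg ‖y - b‖, sq_nonneg ‖x - a‖]
    rwa [sub_eq_zero.1 h7, sub_eq_zero.1 h8]
  · rintro ⟨x, y⟩ hxy
    refine mem_adjoint.2 fun a b hab => ?_
    rw [← inner_conj_symm, ← mem_adjoint.1 hab _ _ hxy, inner_conj_symm]

/-- For `(x, z) ∈ T* T` with intermediate element `y`, the form `(x, z)` equals `‖y‖²`. -/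
theorem inner_eq_norm_sq {T : Submodule ℂ (E × F)} {x z : E} {y : F}
    (h₁ : (x, y) ∈ T) (h₂ : (y, z) ∈ T.adjoint) : inner ℂ x z = ((‖y‖ ^ 2 : ℝ) : ℂ) := by
  rw [← mem_adjoint.1 h₂ _ _ h₁, inner_self_eq]

/-- For a closed relation `T`, the relation `T* T` is `R⁻¹ - 1` for some `0 ≤ R ≤ 1`. -/
theorem exists_resolvent [CompleteSpace E] [CompleteSpace F] {T : Submodule ℂ (E × F)}
    (hT : IsClosed (T : Set (E × F))) :
    ∃ R : E →L[ℂ] E, 0 ≤ R ∧ 0 ≤ 1 - R ∧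
      ∀ x y, (x, y) ∈ prod T.adjoint T ↔ ∃ g, x = R g ∧ y = (1 - R) g := by
  obtain ⟨P, hP⟩ := exists_projection hT
  -- `R = (1 + T*T)⁻¹`: `R g` is the first component of the projection of `(g, 0)` onto `T`.
  let R : E →L[ℂ] E := ContinuousLinearMap.fst ℂ E F ∘L P ∘L ContinuousLinearMap.inl ℂ E F
  have key : ∀ g, ∃ e, (R g, e) ∈ T ∧ (e, g - R g) ∈ T.adjoint := by
    intro g
    refine ⟨(P (g, 0)).2, (hP (g, 0)).1, ?_⟩
    have := T.adjoint.neg_mem (hP (g, 0)).2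
    simpa [R] using this
  have hinj : ∀ x y e, (x, e) ∈ T → (e, y) ∈ T.adjoint → x = R (x + y) := by
    intro x y e h1 h2
    obtain ⟨e', h3, h4⟩ := key (x + y)
    have h5 := inner_eq_norm_sq (T.sub_mem h1 h3) (T.adjoint.sub_mem h2 h4)
    rw [show y - (x + y - R (x + y)) = -(x - R (x + y)) by abel, inner_neg_right,
      inner_self_eq] at h5
    have h6 : -‖x - R (x + y)‖ ^ 2 = ‖e - e'‖ ^ 2 := by exact_mod_cast h5
    rw [← sub_eq_zero, ← norm_eq_zero]
    nlinarith [sq_nonneg ‖x - R (x + y)‖, sq_nonneg ‖e - e'‖]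
  have hpos : ∀ g, ∃ r : ℝ, 0 ≤ r ∧ inner ℂ (R g) (g - R g) = (r : ℂ) := by
    intro g
    obtain ⟨e, h1, h2⟩ := key g
    exact ⟨‖e‖ ^ 2, by positivity, inner_eq_norm_sq h1 h2⟩
  refine ⟨R, ?_, ?_, fun x y => ⟨?_, ?_⟩⟩
  · rw [nonneg_iff_isPositive, isPositive_iff_complex]
    intro g
    obtain ⟨r, hr, h⟩ := hpos g
    have h' : inner ℂ (R g) g = ((r + ‖R g‖ ^ 2 : ℝ) : ℂ) := by
      rw [inner_sub_right, inner_self_eq] at h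
      rw [Complex.ofReal_add]
      linear_combination h
    rw [h']
    refine ⟨rfl, ?_⟩
    rw [RCLike.re_to_complex, Complex.ofReal_re]
    positivity
  · rw [nonneg_iff_isPositive, isPositive_iff_complex]
    intro g
    obtain ⟨r, hr, h⟩ := hpos g
    have h' : inner ℂ ((1 - R) g) g = ((r + ‖g - R g‖ ^ 2 : ℝ) : ℂ) := by
      have h2 : inner ℂ (g - R g) (R g) = (r : ℂ) := by
        rw [← inner_conj_symm, h, Complex.conj_ofReal]
      have h3 := inner_self_eq (g - R g)
      rw [inner_sub_right] at h3
      rw [Complex.ofReal_add]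
      change inner ℂ (g - R g) g = _
      linear_combination h3 + h2
    rw [h']
    refine ⟨rfl, ?_⟩
    rw [RCLike.re_to_complex, Complex.ofReal_re]
    positivity
  · rintro ⟨e, h1, h2⟩
    have h3 := hinj x y e h1 h2
    refine ⟨x + y, h3, ?_⟩
    change y = x + y - R (x + y)
    rw [← h3, add_sub_cancel_left]
  · rintro ⟨g, rfl, rfl⟩
    exact key g

/-- With `R = (1 + T*T)⁻¹`, the root is parametrized as `{(R^{1/2} z, (1 - R)^{1/2} z)}`, which
avoids any unbounded functional calculus. -/
theorem exists_isSqrt [CompleteSpace E] [CompleteSpace F] {T : Submodule ℂ (E × F)}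
    (hT : IsClosed (T : Set (E × F))) : ∃ K, IsSqrt K (prod T.adjoint T) := by
  obtain ⟨R, hR, hR', hmem⟩ := exists_resolvent hT
  let C := CFC.sqrt R
  let S := CFC.sqrt (1 - R)
  have hC : 0 ≤ C := CFC.sqrt_nonneg R
  have hS : 0 ≤ S := CFC.sqrt_nonneg (1 - R)
  have hCC : C * C = R := CFC.sqrt_mul_sqrt_self R hR
  have hSS : S * S = 1 - R := CFC.sqrt_mul_sqrt_self (1 - R) hR'
  have hcomm : Commute C S := by
    have h1 : Commute R (1 - R) := (Commute.one_right R).sub_right (Commute.refl R)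
    have h2 : Commute C (1 - R) := h1.cfcₙ_nnreal _
    exact (h2.symm.cfcₙ_nnreal _).symm
  have hSC : 0 ≤ S * C := hcomm.symm.mul_nonneg hS hC
  have hCs : ∀ x y, inner ℂ (C x) y = inner ℂ x (C y) :=
    fun x y => ((nonneg_iff_isPositive C).1 hC).isSymmetric x y
  have hSs : ∀ x y, inner ℂ (S x) y = inner ℂ x (S y) :=
    fun x y => ((nonneg_iff_isPositive S).1 hS).isSymmetric x y
  have hCCa : ∀ x, C (C x) = R x := fun x => by rw [← hCC]; rfl
  have hSSa : ∀ x, S (S x) = x - R x := fun x => by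
    have := congrArg (fun L : E →L[ℂ] E => L x) hSS
    exact this
  have hCSa : ∀ x, C (S x) = S (C x) := fun x =>
    congrArg (fun L : E →L[ℂ] E => L x) hcomm.eq
  -- Since `C² + S² = 1` and `C`, `S` commute, `z = C x + S y` inverts the parametrization.
  have hsolve : ∀ x y, S x = C y → ∃ z, C z = x ∧ S z = y := by
    intro x y h
    refine ⟨C x + S y, ?_, ?_⟩
    · rw [map_add, hCCa, hCSa, ← h, hSSa]; abel
    · rw [map_add, ← hCSa, h, hCCa, hSSa]; abel
  let K : Submodule ℂ (E × E) := LinearMap.range ((C.prod S : E →L[ℂ] E × E) : E →ₗ[ℂ] E × E)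
  have hK : ∀ x y, (x, y) ∈ K ↔ ∃ z, C z = x ∧ S z = y := by
    intro x y
    simp [K, LinearMap.mem_range]
  refine ⟨K, ?_, ?_, ?_⟩
  · intro h h' hh
    obtain ⟨z, rfl, rfl⟩ := (hK _ _).1 hh
    have h1 := (isPositive_iff_complex _).1 ((nonneg_iff_isPositive _).1 hSC) z
    have h2 : inner ℂ (S z) (C z) = inner ℂ ((S * C) z) z := by
      rw [← hCs, hCSa]; rfl
    rw [h2]
    refine ⟨h1.2, ?_⟩
    rw [← h1.1]
    exact Complex.ofReal_im _
  · ext ⟨x, y⟩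
    rw [hK, mem_adjoint]
    constructor
    · intro h
      apply hsolve
      apply ext_inner_left ℂ
      intro v
      rw [← hSs, ← hCs]
      exact h _ _ ((hK _ _).2 ⟨v, rfl, rfl⟩)
    · rintro ⟨z, rfl, rfl⟩ a b hab
      obtain ⟨v, rfl, rfl⟩ := (hK _ _).1 hab
      rw [hSs, hCs, hCSa]
  · ext ⟨x, y⟩
    rw [hmem, mem_prod]
    constructor
    · rintro ⟨w, h1, h2⟩
      obtain ⟨u, rfl, hu⟩ := (hK _ _).1 h1
      obtain ⟨v, hv, rfl⟩ := (hK _ _).1 h2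
      obtain ⟨z, rfl, rfl⟩ := hsolve u v (hu.trans hv.symm)
      exact ⟨z, hCCa z, hSSa z⟩
    · rintro ⟨g, rfl, rfl⟩
      refine ⟨S (C g), (hK _ _).2 ⟨C g, hCCa g, rfl⟩, (hK _ _).2 ⟨S g, hCSa g, hSSa g⟩⟩

end Hilbert

end LinRel

namespace LinRel

/-! ### Domination and the order on relations. -/

section Hilbert

variable {E F G L : Type*} [NormedAddCommGroup E] [InnerProductSpace ℂ E]
  [NormedAddCommGroup F] [InnerProductSpace ℂ F] [NormedAddCommGroup G] [InnerProductSpace ℂ G]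
  [NormedAddCommGroup L] [InnerProductSpace ℂ L]

theorem IsSqrt.isClosed {K H : Submodule ℂ (E × E)} (h : IsSqrt K H) :
    IsClosed (K : Set (E × E)) :=
  h.2.1 ▸ isClosed_adjoint K

theorem IsSqrt.scale {K H : Submodule ℂ (E × E)} (h : IsSqrt K H) {c : ℝ} (hc : 0 < c) :
    IsSqrt (scale (c : ℂ) K) (scale ((c : ℂ) ^ 2) H) := by
  have hc0 : (c : ℂ) ≠ 0 := by exact_mod_cast hc.ne'
  have hc2 : (c : ℂ) ^ 2 ≠ 0 := pow_ne_zero 2 hc0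
  refine ⟨?_, ?_, ?_⟩
  · intro x y hxy
    obtain ⟨z, hz, rfl⟩ := mem_scale.1 hxy
    obtain ⟨h1, h2⟩ := h.1 x z hz
    rw [inner_smul_left, Complex.conj_ofReal, Complex.re_ofReal_mul, Complex.im_ofReal_mul, h2,
      mul_zero]
    exact ⟨mul_nonneg hc.le h1, rfl⟩
  · ext ⟨x, y⟩
    rw [mem_scale_iff hc0, ← h.2.1, mem_adjoint, mem_adjoint, h.2.1]
    constructor
    · intro h1 a b hab
      have h2 := h1 a ((c : ℂ) • b) (mem_scale.2 ⟨b, hab, rfl⟩)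
      rw [inner_smul_left, Complex.conj_ofReal] at h2
      rw [inner_smul_right, ← h2, inv_mul_cancel_left₀ hc0]
    · intro h1 a b hab
      obtain ⟨z, hz, rfl⟩ := mem_scale.1 hab
      rw [inner_smul_left, Complex.conj_ofReal, h1 a z hz, inner_smul_right,
        mul_inv_cancel_left₀ hc0]
  · ext ⟨x, y⟩
    rw [mem_scale_iff hc2, ← h.2.2, mem_prod, mem_prod]
    constructor
    · rintro ⟨z, h1, h2⟩
      rw [mem_scale_iff hc0] at h1 h2
      refine ⟨_, h1, ?_⟩
      have := K.smul_mem (c : ℂ)⁻¹ h2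
      rwa [Prod.smul_mk, smul_smul, ← mul_inv, ← sq] at this
    · rintro ⟨z, h1, h2⟩
      refine ⟨(c : ℂ) • z, mem_scale.2 ⟨z, h1, rfl⟩, mem_scale.2 ⟨_, K.smul_mem (c : ℂ) h2, ?_⟩⟩
      dsimp only
      rw [smul_smul, smul_smul, ← sq, mul_inv_cancel₀ hc2, one_smul]

/-- The relation `S` is dominated by `T` with constant `c`: `dom T ⊆ dom S`, and `S` has values
at most `c` times as large as those of `T`. -/
def Dominated (c : ℝ) (S : Submodule ℂ (E × F)) (T : Submodule ℂ (E × G)) : Prop :=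
  ∀ x y, (x, y) ∈ T → ∃ z, (x, z) ∈ S ∧ ‖z‖ ≤ c * ‖y‖

theorem Dominated.trans {c d : ℝ} (hc : 0 ≤ c) {S : Submodule ℂ (E × F)}
    {T : Submodule ℂ (E × G)} {U : Submodule ℂ (E × L)} (h₁ : Dominated c S T)
    (h₂ : Dominated d T U) : Dominated (c * d) S U := by
  intro x y hxy
  obtain ⟨z, hz, hzy⟩ := h₂ x y hxy
  obtain ⟨w, hw, hwz⟩ := h₁ x z hz
  exact ⟨w, hw, hwz.trans (by rw [mul_assoc]; exact mul_le_mul_of_nonneg_left hzy hc)⟩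

/-- The operator part selects the value of least norm, so any value within the bound suffices. -/
theorem le_iff_exists_dominated [CompleteSpace E] {H₁ H₂ : Submodule ℂ (E × E)} :
    Le H₁ H₂ ↔ ∃ K₁ K₂, IsSqrt K₁ H₁ ∧ IsSqrt K₂ H₂ ∧ Dominated 1 K₁ K₂ := by
  constructor
  · rintro ⟨K₁, K₂, h₁, h₂, hdom, hle⟩
    refine ⟨K₁, K₂, h₁, h₂, fun x y hxy => ?_⟩
    obtain ⟨z, hz, hzy⟩ := exists_mem_opPart h₂.isClosed hxy
    obtain ⟨w, hw⟩ := mem_dom.1 (hdom (mem_dom.2 ⟨z, hz⟩))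
    exact ⟨w, hw.1, by rw [one_mul]; exact (hle x w z hw hz).trans hzy⟩
  · rintro ⟨K₁, K₂, h₁, h₂, h⟩
    refine ⟨K₁, K₂, h₁, h₂, fun x hx => ?_, fun x y z hy hz => ?_⟩
    · obtain ⟨y, hy⟩ := mem_dom.1 hx
      obtain ⟨z, hz, -⟩ := h x y hy.1
      obtain ⟨w, hw, -⟩ := exists_mem_opPart h₁.isClosed hz
      exact mem_dom.2 ⟨w, hw⟩
    · obtain ⟨w, hw, hwz⟩ := h x z hz.1
      rw [one_mul] at hwz
      exact (norm_le_of_mem_opPart hy hw).trans hwz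

/-- For a closed relation `T`, the domain of `T* T` is a core of the operator part of `T`. -/
theorem opPart_le_closure_core [CompleteSpace E] [CompleteSpace F] {T : Submodule ℂ (E × F)}
    (hT : IsClosed (T : Set (E × F))) {p : E × F} (hp : p ∈ opPart T) :
    p ∈ (T ⊓ (dom T.adjoint).comap (LinearMap.snd ℂ E F)).topologicalClosure := by
  set M := T ⊓ (dom T.adjoint).comap (LinearMap.snd ℂ E F)
  obtain ⟨Q, hQ⟩ := exists_projection M.isClosed_topologicalClosure
  obtain ⟨q, hq, hpq⟩ : ∃ q ∈ M.topologicalClosure,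
      (p.2 - q.2, q.1 - p.1) ∈ M.topologicalClosure.adjoint := ⟨Q p, hQ p⟩
  have hMT : M.topologicalClosure ≤ opPart T := by
    apply M.topologicalClosure_minimal _ (isClosed_opPart hT)
    rintro ⟨d, e⟩ ⟨hde, he⟩
    refine ⟨hde, fun m hm => ?_⟩
    obtain ⟨d', hd'⟩ := mem_dom.1 he
    simpa using mem_adjoint.1 hd' 0 m hm
  obtain ⟨u, hu⟩ : ∃ u, u = p.1 - q.1 := ⟨_, rfl⟩
  obtain ⟨v, hv⟩ : ∃ v, v = p.2 - q.2 := ⟨_, rfl⟩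
  have huv : (u, v) ∈ opPart T := by
    have := (opPart T).sub_mem hp (hMT hq)
    rw [hu, hv]
    exact this
  have hperp : (v, -u) ∈ M.topologicalClosure.adjoint := by
    rw [hu, hv, neg_sub]
    exact hpq
  obtain ⟨R, -, -, hR⟩ := exists_resolvent hT
  -- The residual `(u, v)` is orthogonal to the core; testing against the core element over `R u`
  -- gives `(u, u) = 0`.
  have hu0 : u = 0 := by
    obtain ⟨e, h1, h2⟩ := (hR (R u) ((1 - R) u)).2 ⟨u, rfl, rfl⟩
    have h3 := mem_adjoint.1 hperp (R u) e
      (M.le_topologicalClosure ⟨h1, mem_dom.2 ⟨_, h2⟩⟩)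
    have h4 := mem_adjoint.1 h2 u v huv.1
    have h5 : inner ℂ ((1 - R) u) u = inner ℂ e v := by
      rw [← inner_conj_symm, ← h4, inner_conj_symm]
    have h6 : inner ℂ u u = 0 := by
      have h7 : inner ℂ (R u) u + inner ℂ ((1 - R) u) u = inner ℂ u u := by
        rw [← inner_add_left]
        congr 1
        change R u + (u - R u) = u
        abel
      rw [← h7, h5, h3, inner_neg_right, add_neg_cancel]
    exact inner_self_eq_zero.1 h6
  have hv0 : v = 0 := by
    rw [hu0] at huv
    exact inner_self_eq_zero.1 (huv.2 v huv.1)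
  have hpq' : p = q :=
    Prod.ext (sub_eq_zero.1 (hu.symm.trans hu0)) (sub_eq_zero.1 (hv.symm.trans hv0))
  rwa [hpq']

theorem dominated_of_core [CompleteSpace E] [CompleteSpace F] [CompleteSpace G] {c : ℝ}
    (hc : 0 ≤ c) {S : Submodule ℂ (E × F)} {T : Submodule ℂ (E × G)}
    (hS : IsClosed (S : Set (E × F))) (hT : IsClosed (T : Set (E × G)))
    (h : ∀ x y w, (x, y) ∈ T → (y, w) ∈ T.adjoint → ∃ z, (x, z) ∈ S ∧ ‖z‖ ≤ c * ‖y‖) :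
    Dominated c S T := by
  have key : ∀ p : E × G, p ∈ T ⊓ (dom T.adjoint).comap (LinearMap.snd ℂ E G) →
      ∃ z, (p.1, z) ∈ opPart S ∧ ‖z‖ ≤ c * ‖p.2‖ := by
    rintro ⟨x, y⟩ ⟨hxy, hy⟩
    obtain ⟨w, hw⟩ := mem_dom.1 hy
    obtain ⟨z, hz, hzy⟩ := h x y w hxy hw
    obtain ⟨z', hz', hle⟩ := exists_mem_opPart hS hz
    exact ⟨z', hz', hle.trans hzy⟩
  intro x y hxy
  obtain ⟨y', hy', hle⟩ := exists_mem_opPart hT hxy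
  have hcl := opPart_le_closure_core hT hy'
  rw [← SetLike.mem_coe, Submodule.topologicalClosure_coe, mem_closure_iff_seq_limit] at hcl
  obtain ⟨p, hpM, hp⟩ := hcl
  choose z hz hzle using fun n => key (p n) (hpM n)
  have hp1 : Filter.Tendsto (fun n => (p n).1) Filter.atTop (nhds x) :=
    (continuous_fst.tendsto _).comp hp
  have hp2 : Filter.Tendsto (fun n => (p n).2) Filter.atTop (nhds y') :=
    (continuous_snd.tendsto _).comp hp
  -- Values in the operator part are unique, so `z m - z n` is the value at the difference and
  -- inherits the bound.
  have hdist : ∀ m n, dist (z m) (z n) ≤ c * dist (p m).2 (p n).2 := by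
    intro m n
    obtain ⟨t, ht, htle⟩ := key _ (Submodule.sub_mem _ (hpM m) (hpM n))
    rw [dist_eq_norm, dist_eq_norm]
    exact (norm_le_of_mem_opPart ((opPart S).sub_mem (hz m) (hz n)) ht.1).trans htle
  have hcauchy : CauchySeq z := by
    rw [cauchySeq_iff_tendsto_dist_atTop_0]
    have h1 := (cauchySeq_iff_tendsto_dist_atTop_0.1 hp2.cauchySeq).const_mul c
    rw [mul_zero] at h1
    exact squeeze_zero (fun _ => dist_nonneg) (fun _ => hdist _ _) h1
  obtain ⟨s, hs⟩ := cauchySeq_tendsto_of_complete hcauchy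
  refine ⟨s, ?_, ?_⟩
  · exact hS.mem_of_tendsto (hp1.prodMk_nhds hs) (Filter.Eventually.of_forall fun n => (hz n).1)
  · have h1 : ‖s‖ ≤ c * ‖y'‖ :=
      le_of_tendsto_of_tendsto' hs.norm (hp2.norm.const_mul c) hzle
    exact h1.trans (mul_le_mul_of_nonneg_left hle hc)

theorem dominated_of_adjoint_prod [CompleteSpace E] [CompleteSpace F] [CompleteSpace G] {c : ℝ}
    (hc : 0 ≤ c) {S : Submodule ℂ (E × F)} {T : Submodule ℂ (E × G)}
    (hS : IsClosed (S : Set (E × F))) (hT : IsClosed (T : Set (E × G)))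
    (h : ∀ x w, (x, w) ∈ prod T.adjoint T → (x, (c : ℂ) ^ 2 • w) ∈ prod S.adjoint S) :
    Dominated c S T := by
  refine dominated_of_core hc hS hT fun x y w h1 h2 => ?_
  obtain ⟨z, h3, h4⟩ := h x w ⟨y, h1, h2⟩
  refine ⟨z, h3, ?_⟩
  have h5 := inner_eq_norm_sq h3 h4
  rw [inner_smul_right, inner_eq_norm_sq h1 h2] at h5
  have h6 : c ^ 2 * ‖y‖ ^ 2 = ‖z‖ ^ 2 := by exact_mod_cast h5
  rw [← mul_pow] at h6
  exact (pow_le_pow_iff_left₀ (norm_nonneg z) (by positivity) two_ne_zero).1 h6.ge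

/-- The product inequality for `A A*` and `B B*` is domination of `A*` by `B*`. -/
theorem exists_le_scale_iff [CompleteSpace E] [CompleteSpace F] [CompleteSpace G]
    {A : Submodule ℂ (F × E)} {B : Submodule ℂ (G × E)}
    (hA : IsClosed (A : Set (F × E))) (hB : IsClosed (B : Set (G × E))) :
    (∃ c : ℝ, 0 ≤ c ∧ Le (prod A A.adjoint) (scale ((c : ℂ) ^ 2) (prod B B.adjoint))) ↔
      ∃ c : ℝ, 0 ≤ c ∧ Dominated c A.adjoint B.adjoint := by
  have hA' := isClosed_adjoint A
  have hB' := isClosed_adjoint B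
  constructor
  · rintro ⟨c, hc, hle⟩
    obtain ⟨K₁, K₂, h₁, h₂, h⟩ := le_iff_exists_dominated.1 hle
    refine ⟨1 * (1 * c), by positivity, ?_⟩
    refine Dominated.trans zero_le_one ?_ (h.trans zero_le_one ?_)
    · refine dominated_of_adjoint_prod zero_le_one hA' h₁.isClosed fun x w hw => ?_
      rw [adjoint_adjoint hA, ← h₁.2.2]
      rw [h₁.2.1] at hw
      simpa using hw
    · refine dominated_of_adjoint_prod hc h₂.isClosed hB' fun x w hw => ?_
      rw [adjoint_adjoint hB] at hw
      rw [h₂.2.1, h₂.2.2]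
      exact mem_scale.2 ⟨w, hw, rfl⟩
  · rintro ⟨c, hc, h⟩
    obtain ⟨K₁, h₁⟩ := exists_isSqrt hA'
    obtain ⟨K₂, h₂⟩ := exists_isSqrt hB'
    rw [adjoint_adjoint hA] at h₁
    rw [adjoint_adjoint hB] at h₂
    have hK : Dominated (1 * (c * 1)) K₁ K₂ := by
      refine Dominated.trans zero_le_one ?_ (h.trans hc ?_)
      · refine dominated_of_adjoint_prod zero_le_one h₁.isClosed hA' fun x w hw => ?_
        rw [adjoint_adjoint hA, ← h₁.2.2] at hw
        rw [h₁.2.1]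
        simpa using hw
      · refine dominated_of_adjoint_prod zero_le_one hB' h₂.isClosed fun x w hw => ?_
        rw [h₂.2.1, h₂.2.2] at hw
        rw [adjoint_adjoint hB]
        simpa using hw
    -- `IsSqrt.scale` needs a positive factor, and `c` may be zero.
    have hc1 : 0 < c + 1 := by positivity
    refine ⟨c + 1, hc1.le, le_iff_exists_dominated.2
      ⟨K₁, _, h₁, h₂.scale hc1, fun x y hxy => ?_⟩⟩
    obtain ⟨z, hz, rfl⟩ := mem_scale.1 hxy
    obtain ⟨w, hw, hwz⟩ := hK x z hz
    refine ⟨w, hw, hwz.trans ?_⟩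
    rw [norm_smul, Complex.norm_real, Real.norm_of_nonneg hc1.le]
    nlinarith [norm_nonneg z]

/-! ### Factorization through a bounded operator. -/

/-- A linear map `f` that is bounded relative to `e` factors as `Z ∘ e` with `Z` bounded and
vanishing on the orthogonal complement of the range of `e`. -/
theorem exists_factorization {X : Type*} [AddCommGroup X] [Module ℂ X] [CompleteSpace E]
    [CompleteSpace F] (e : X →ₗ[ℂ] E) (f : X →ₗ[ℂ] F) {C : ℝ} (h : ∀ x, ‖f x‖ ≤ C * ‖e x‖) :
    ∃ Z : E →L[ℂ] F, (∀ x, Z (e x) = f x) ∧ ∀ y ∈ (LinearMap.range e)ᗮ, Z y = 0 := by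
  let U := (LinearMap.range e).topologicalClosure
  have hU : ∀ x, e x ∈ U := fun x =>
    (LinearMap.range e).le_topologicalClosure (LinearMap.mem_range_self e x)
  have : CompleteSpace U :=
    (LinearMap.range e).isClosed_topologicalClosure.completeSpace_coe
  let e' : X →ₗ[ℂ] U := e.codRestrict U hU
  have hd : DenseRange e' := by
    intro u
    rw [closure_subtype, ← Set.range_comp]
    exact u.2
  refine ⟨f.extendOfNorm e' ∘L U.orthogonalProjectionOnto, fun x => ?_, fun y hy => ?_⟩
  · have h1 : U.orthogonalProjectionOnto (e x) = e' x :=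
      Submodule.orthogonalProjectionOnto_mem_subspace_eq_self (e' x)
    rw [ContinuousLinearMap.comp_apply, h1]
    exact LinearMap.extendOfNorm_eq hd ⟨C, h⟩ x
  · have h1 : U.orthogonalProjectionOnto y = 0 := by
      rw [Submodule.orthogonalProjectionOnto_eq_zero_iff, Submodule.orthogonal_closure]
      exact hy
    rw [ContinuousLinearMap.comp_apply, h1, map_zero]

theorem mul_adjoint (T : Submodule ℂ (E × F)) : mul T.adjoint = (dom T)ᗮ := by
  ext y
  rw [mem_mul, mem_adjoint, Submodule.mem_orthogonal]
  constructor
  · intro h a ha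
    obtain ⟨b, hb⟩ := mem_dom.1 ha
    rw [← h a b hb, inner_zero_right]
  · intro h a b hab
    rw [h a (mem_dom.2 ⟨b, hab⟩), inner_zero_right]

theorem mul_prod_ofMap {D : Submodule ℂ E} {R : Submodule ℂ F} (B : Submodule ℂ (F × G))
    (W : D →ₗ[ℂ] R) : mul (prod B (ofMap W)) = mul B := by
  ext y
  rw [mem_mul, mem_prod, mem_mul]
  constructor
  · rintro ⟨x, hx, hxy⟩
    obtain ⟨h0, rfl⟩ := mem_ofMap.1 hx
    have : W ⟨0, h0⟩ = 0 := map_zero W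
    rwa [this] at hxy
  · intro h
    refine ⟨0, mem_ofMap.2 ⟨D.zero_mem, ?_⟩, h⟩
    have : W ⟨0, D.zero_mem⟩ = 0 := map_zero W
    rw [this]
    rfl

theorem dominated_adjoint_of_eq_prod [CompleteSpace E] [CompleteSpace F] {A : Submodule ℂ (E × G)}
    {B : Submodule ℂ (F × G)} (W : dom A →L[ℂ] (dom B).topologicalClosure)
    (h : A = prod B (ofMap W.toLinearMap)) :
    ∃ c : ℝ, 0 ≤ c ∧ Dominated c A.adjoint B.adjoint := by
  obtain ⟨Z, hZ, -⟩ := exists_factorization (dom A).subtype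
    ((dom B).topologicalClosure.subtype.comp W.toLinearMap) (C := ‖W‖) fun x => W.le_opNorm x
  refine ⟨‖Z.adjoint‖, norm_nonneg _, fun x y hxy => ⟨Z.adjoint y, ?_, Z.adjoint.le_opNorm y⟩⟩
  refine mem_adjoint.2 fun a b hab => ?_
  rw [h] at hab
  obtain ⟨w, hw, hwb⟩ := hab
  obtain ⟨ha, rfl⟩ := mem_ofMap.1 hw
  rw [mem_adjoint.1 hxy _ _ hwb, ContinuousLinearMap.adjoint_inner_right]
  congr 1
  exact (hZ ⟨a, ha⟩).symm

theorem exists_eq_prod_of_dominated_adjoint [CompleteSpace E] [CompleteSpace F] [CompleteSpace G]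
    {A : Submodule ℂ (E × G)} {B : Submodule ℂ (F × G)} (hB : IsClosed (B : Set (F × G)))
    {c : ℝ} (h : Dominated c A.adjoint B.adjoint) (hmul : mul A = mul B) :
    ∃ W : dom A →L[ℂ] (dom B).topologicalClosure, A = prod B (ofMap W.toLinearMap) := by
  -- `X` consists of pairs `((x, A*_s x), (x, B*_s x))`; `e` and `f` read off `B*_s x` and `A*_s x`.
  let X : Submodule ℂ ((G × E) × (G × F)) :=
    ((opPart A.adjoint).prod (opPart B.adjoint)) ⊓
      LinearMap.eqLocus (LinearMap.fst ℂ G E ∘ₗ LinearMap.fst ℂ (G × E) (G × F))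
        (LinearMap.fst ℂ G F ∘ₗ LinearMap.snd ℂ (G × E) (G × F))
  let e : X →ₗ[ℂ] F := LinearMap.snd ℂ G F ∘ₗ LinearMap.snd ℂ (G × E) (G × F) ∘ₗ X.subtype
  let f : X →ₗ[ℂ] E := LinearMap.snd ℂ G E ∘ₗ LinearMap.fst ℂ (G × E) (G × F) ∘ₗ X.subtype
  obtain ⟨Z, hZ, hZ0⟩ := exists_factorization e f (C := c) (by
    rintro ⟨⟨⟨x, y⟩, x', z⟩, ⟨hy, hz⟩, hx⟩
    obtain rfl : x = x' := hx
    obtain ⟨w, hw, hwz⟩ := h x z hz.1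
    exact (norm_le_of_mem_opPart hy hw).trans hwz)
  -- `B*_s` has range orthogonal to `mul B* = (dom B)ᗮ`, so `Z` kills `(dom B)ᗮ`.
  have hZmem : ∀ u, Z.adjoint u ∈ (dom B).topologicalClosure := by
    intro u
    rw [← Submodule.orthogonal_orthogonal_eq_closure]
    intro v hv
    rw [ContinuousLinearMap.adjoint_inner_right, hZ0 v, inner_zero_left]
    rintro - ⟨⟨⟨p, x, z⟩, ⟨-, hz⟩, -⟩, rfl⟩
    have h1 := hz.2
    rw [mul_adjoint] at h1
    exact Submodule.inner_left_of_mem_orthogonal hv h1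
  let W : dom A →L[ℂ] (dom B).topologicalClosure :=
    (Z.adjoint ∘L (dom A).subtypeL).codRestrict _ fun u => hZmem u
  have hW : ∀ x y, (x, y) ∈ A → (Z.adjoint x, y) ∈ B := by
    intro x y hxy
    rw [← adjoint_adjoint hB, mem_adjoint]
    intro a b hab
    obtain ⟨b', hb', -⟩ := exists_mem_opPart (isClosed_adjoint B) hab
    obtain ⟨t, ht, -⟩ := h a b hab
    obtain ⟨t', ht', -⟩ := exists_mem_opPart (isClosed_adjoint A) ht
    have hZb : Z b' = t' := hZ ⟨((a, t'), (a, b')), ⟨ht', hb'⟩, rfl⟩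
    -- Passing from `b` to `b'` costs nothing: the difference is orthogonal to the range of `Z*`.
    have hbb : b - b' ∈ (dom B)ᗮ := by
      rw [← mul_adjoint, mem_mul]
      simpa using B.adjoint.sub_mem hab hb'.1
    have h1 : inner ℂ (b - b') (Z.adjoint x) = 0 := by
      rw [← Submodule.orthogonal_closure] at hbb
      exact Submodule.inner_left_of_mem_orthogonal (hZmem x) hbb
    rw [inner_sub_left, sub_eq_zero] at h1
    rw [h1, ContinuousLinearMap.adjoint_inner_right, hZb, ← inner_conj_symm,
      ← mem_adjoint.1 ht'.1 x y hxy, inner_conj_symm]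
  refine ⟨W, ?_⟩
  ext ⟨x, y⟩
  rw [mem_prod]
  constructor
  · intro hxy
    exact ⟨Z.adjoint x, mem_ofMap.2 ⟨mem_dom.2 ⟨y, hxy⟩, rfl⟩, hW x y hxy⟩
  · rintro ⟨w, hw, hwy⟩
    obtain ⟨hx, rfl⟩ := mem_ofMap.1 hw
    obtain ⟨y', hy'⟩ := mem_dom.1 hx
    -- Two values of `B` at `Z* x` differ by an element of `mul B = mul A`.
    have h1 : y - y' ∈ mul A := by
      rw [hmul, mem_mul]
      have h2 : (Z.adjoint x, y) ∈ B := hwy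
      simpa using B.sub_mem h2 (hW x y' hy')
    simpa using A.add_mem hy' (mem_mul.1 h1)

end Hilbert

end LinRel

theorem mainTheorem6
    {HA HB H : Type*}
    [NormedAddCommGroup HA] [InnerProductSpace ℂ HA] [CompleteSpace HA]
    [NormedAddCommGroup HB] [InnerProductSpace ℂ HB] [CompleteSpace HB]
    [NormedAddCommGroup H] [InnerProductSpace ℂ H] [CompleteSpace H]
    (A : Submodule ℂ (HA × H)) (B : Submodule ℂ (HB × H))
    (hA : IsClosed (A : Set (HA × H))) (hB : IsClosed (B : Set (HB × H))) :
    (∃ W : LinRel.dom A →L[ℂ] (LinRel.dom B).topologicalClosure,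
        A = LinRel.prod B (LinRel.ofMap W.toLinearMap)) ↔
      (∃ c : ℝ, 0 ≤ c ∧
        LinRel.Le (LinRel.prod A A.adjoint)
          (LinRel.scale ((c : ℂ) ^ 2) (LinRel.prod B B.adjoint))) ∧
      LinRel.mul A = LinRel.mul B := by
  rw [LinRel.exists_le_scale_iff hA hB]
  constructor
  · rintro ⟨W, hW⟩
    refine ⟨LinRel.dominated_adjoint_of_eq_prod W hW, ?_⟩
    conv_lhs => rw [hW]
    exact LinRel.mul_prod_ofMap B W.toLinearMap
  · rintro ⟨⟨c, -, h⟩, hmul⟩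
    exact LinRel.exists_eq_prod_of_dominated_adjoint hB h hmul
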